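/- Let $\mathcal X$ be a measurable space, $\mathcal Y=\{1,\dots,C\}$, $\mathcal Z=\mathcal X\times\mathcal Y$, let $\mathcal D$ be a probability distribution on $\mathcal Z$, and let $\mathcal S=(\boldsymbol z^{(1)},\dots,\boldsymbol z^{(n)})$, $\boldsymbol z^{(i)}=(\boldsymbol x^{(i)},y^{(i)})$, $n\ge 1$, be sampled i.i.d. from $\mathcal D$. Let $\mathcal F$ be a set of measurable score functions $f:\mathcal X\to\mathbb R^C$, and let $L$ be a loss $L(y,\boldsymbol s)\in\mathbb R$, $y\in\mathcal Y$, $\boldsymbol s\in\mathbb R^C$, such that, for some $B>0$, $0\le L(y,f(\boldsymbol x))\le B$ for all $f\in\mathcal F$, $\boldsymbol x\in\mathcal X$, $y\in\mathcal Y$. Put $$\mathcal R(f)=\mathbb E_{(\boldsymbol x,y)\sim\mathcal D}\,L(y,f(\boldsymbol x)),\qquad \hat{\mathcal R}(f,\mathcal S)=\frac1n\sum_{i=1}^n L\big(y^{(i)},f(\boldsymbol x^{(i)})\big),$$ $$\Phi(\mathcal S,\delta)=\sup_{f\in\mathcal F}\big(\mathcal R(f)-\hat{\mathcal R}(f,\mathcal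 S)\big)-3B\sqrt{\frac{\log(2/\delta)}{2n}}.$$ (The surrogate AUTKC risk is the case $L(y,\boldsymbol s)=\frac1K\sum_{k=1}^{K+1}\ell(s_y-s_{[k]})$, where $s_{[k]}$ is the $k$-th greatest entry of $\boldsymbol s$.) For a finite family $\mathcal T=(\boldsymbol t_1,\dots,\boldsymbol t_m)$ of points of $\mathcal Z$ and a set $\mathcal H$ of functions $\mathcal Z\to\mathbb R$, let $$\mathfrak G_{\mathcal T}(\mathcal H)=\mathbb E_{\boldsymbol g}\sup_{h\in\mathcal H}\frac1m\sum_{i=1}^m g_i\,h(\boldsymbol t_i)\in[-\infty,\infty],$$ where $g_1,\dots,g_m$ are independent standard normal variables. Let $\widetilde{\mathcal F}=\{(\boldsymbol x,y)\mapsto \boldsymbol e_y^{T}f(\boldsymbol x): f\in\mathcal F\}$, where $\boldsymbol e_y$ is the $y$-th standard basis vector, and let $\widetilde{\mathcal S}=\big((\boldsymbol x^{(i)},j)\big)_{1\le i\le n,\,1\le j\le C}$. Assume that the class $\{(\boldsymbol x,y)\mapsto L(y,f(\boldsymbol x)): f\in\mathcal F\}$ is measurable for $\mathcal D$ in the usual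 sense of empirical process theory: for all $m$ and all $a_1,\dots,a_m\in\mathbb R$, the map $((\boldsymbol x_i,y_i))_{i\le m}\mapsto\sup_{f\in\mathcal F}\sum_{i=1}^m a_i L(y_i,f(\boldsymbol x_i))$ is measurable on the completion of $(\mathcal Z^m,\mathcal D^m)$. Suppose that, with constants $L_1,L_2\ge 0$, for every $y\in\mathcal Y$ and all $\boldsymbol s,\boldsymbol s'\in\mathbb R^C$, $$|L(y,\boldsymbol s)-L(y,\boldsymbol s')|\le L_1\|\boldsymbol s-\boldsymbol s'\|_2+L_2|s_y-s'_y| .$$ Then for every $\delta\in(0,1)$, with probability at least $1-\delta$ over $\mathcal S$, $$\Phi(\mathcal S,\delta)\le 2\sqrt{\pi}\,\Big[L_1\,C\,\mathfrak G_{\widetilde{\mathcal S}}(\widetilde{\mathcal F})+L_2\,\mathfrak G_{\mathcal S}(\widetilde{\mathcal F})\Big]$$ (with the convention $0\cdot\infty=0$ on the right-hand side). -/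

import Mathlib

open MeasureTheory ProbabilityTheory
open scoped ENNReal

noncomputable section

namespace GenBound

/-- A score function `f : X → ℝ^C`, where `ℝ^C` carries its Euclidean norm. -/
abbrev Score (X : Type*) (C : ℕ) : Type _ := X → EuclideanSpace ℝ (Fin C)

/-- A loss `L(y, s)` of a label `y` and a score vector `s`. -/
abbrev Loss (C : ℕ) : Type := Fin C → EuclideanSpace ℝ (Fin C) → ℝ

/-- Expectation `E[h⁺] - E[h⁻]` of an extended-real-valued random variable. -/
def extExp {Ω : Type*} [MeasurableSpace Ω] (P : Measure Ω) (h : Ω → EReal) : EReal :=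
  ((∫⁻ ω, (h ω).toENNReal ∂P : ℝ≥0∞) : EReal) - ((∫⁻ ω, (-h ω).toENNReal ∂P : ℝ≥0∞) : EReal)

/-- Empirical Gaussian complexity of a class `H` of real functions on `Z` with respect to a finite
family `z` of points: the expectation of `sup_{h ∈ H} (1/|ι|) ∑ i, g i * h (z i)` for independent
standard normal `g i`. It is `⊤` if the expectation is infinite. -/
def gaussianComplexity {Z ι : Type*} [Fintype ι] (z : ι → Z) (H : Set (Z → ℝ)) : EReal :=
  extExp (Measure.pi fun _ : ι => gaussianReal 0 1) fun g =>
    ⨆ h ∈ H, ((1 / (Fintype.card ι : ℝ) * ∑ i, g i * h (z i) : ℝ) : EReal)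

/-- The functions `(x, y) ↦ L(y, f x)`, `f ∈ F`. -/
def lossClass {X : Type*} {C : ℕ} (L : Loss C) (F : Set (Score X C)) : Set (X × Fin C → ℝ) :=
  {h | ∃ f ∈ F, h = fun z => L z.2 (f z.1)}

/-- The coordinate functions `(x, y) ↦ e_yᵀ f(x)`, `f ∈ F`. -/
def coordClass {X : Type*} {C : ℕ} (F : Set (Score X C)) : Set (X × Fin C → ℝ) :=
  {h | ∃ f ∈ F, h = fun z => f z.1 z.2}

/-- The expanded sample `(x i, j)`, `i < n`, `j` ranging over all labels. -/
def expandedSample {X : Type*} {C n : ℕ} (S : Fin n → X × Fin C) : Fin n × Fin C → X × Fin C :=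
  fun p => ((S p.1).1, p.2)

/-- The population risk of `f`. -/
def risk {X : Type*} [MeasurableSpace X] {C : ℕ} (D : Measure (X × Fin C)) (L : Loss C)
    (f : Score X C) : ℝ :=
  ∫ z, L z.2 (f z.1) ∂D

/-- The empirical risk of `f` on the sample `S`. -/
def empRisk {X : Type*} {C n : ℕ} (L : Loss C) (S : Fin n → X × Fin C) (f : Score X C) : ℝ :=
  1 / (n : ℝ) * ∑ i, L (S i).2 (f (S i).1)

/-- The generalization gap
`Φ(S, δ) = sup_{f ∈ F} (R(f) - R̂(f, S)) - 3 B √(log (2/δ) / (2n))`. -/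
def genGap {X : Type*} [MeasurableSpace X] {C n : ℕ} (D : Measure (X × Fin C)) (L : Loss C)
    (F : Set (Score X C)) (B : ℝ) (S : Fin n → X × Fin C) (δ : ℝ) : EReal :=
  (⨆ f ∈ F, ((risk D L f - empRisk L S f : ℝ) : EReal))
    - ((3 * B * √(Real.log (2 / δ) / (2 * n)) : ℝ) : EReal)

/-- Lipschitz continuity with respect to a variant of the `ℓ²`-norm, with constants `L₁, L₂`. -/
def IsVariantLipschitz {C : ℕ} (L : Loss C) (L₁ L₂ : ℝ) : Prop :=
  ∀ (y : Fin C) (s s' : EuclideanSpace ℝ (Fin C)),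
    |L y s - L y s'| ≤ L₁ * ‖s - s'‖ + L₂ * |s y - s' y|

/-- The usual measurability requirement on an index class of an empirical process: suprema of
finite weighted sums over i.i.d. points are measurable with respect to the completed law. (It holds
for instance if the members of `H` are measurable and are pointwise limits of sequences from a
countable subclass.) -/
def IsMeasurableClass {Z : Type*} [MeasurableSpace Z] (D : Measure Z) (H : Set (Z → ℝ)) : Prop :=
  ∀ (m : ℕ) (e : Fin m → ℝ),
    AEMeasurable (fun z : Fin m → Z => ⨆ h ∈ H, ((∑ i, e i * h (z i) : ℝ) : EReal))
      (Measure.pi fun _ => D)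

end GenBound

end

/-! The uniform deviation of the loss class is bounded by a Rademacher average, which is then
compared with Gaussian averages of the scores.

Deviation: on sums over the sample, every gap is dominated by the ghost-sample functional Ψ(S) =
E_{S'} sup_h Σ (h(S'_i) - h(S_i)). Both Ψ and the empirical Rademacher average V move by at most B
when one point changes. By McDiarmid, Ψ < EΨ + t and EV < V + t with t = B√(n log(2/δ)/2), each
outside an event of probability at most δ/2. Symmetrization gives EΨ ≤ 2 EV, hence Ψ ≤ 2V + 3t; this
is the constant 3 (`exists_uniform_deviation_bound`).

Contraction: a random sign times h(t) may be replaced by a Gaussian linear form ⟨w, u(t)⟩ once |h(t)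
- h(t')| ≤ E|⟨w, u(t) - u(t')⟩| = √(2/π) ‖u(t) - u(t')‖ (`rademacher_le_gaussian`). For the loss, u
has C coordinates √π L₁ s_j and one more, √π L₂ s_y. Splitting the supremum between these two groups
yields the two complexities; the factor C undoes the average over nC points
(`rademacher_lossClass_le`).

Measurability: suprema of the scores over an uncountable F need not be measurable. Contraction is
therefore run on finitely many near-maximizers, one per sign vector, and the Gaussian complexity is
only ever bounded from below. -/

namespace GenBound

/-! ### Bounded differences -/

/-- **McDiarmid's inequality**, in the form of a bound on the moment generating function: a bounded
function of `n` i.i.d. variables that changes by at most `c` when one argument is changed is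
sub-Gaussian around its mean with variance proxy `n (c / 2) ^ 2`. -/
theorem hasSubgaussianMGF_pi_of_bounded_differences {Z : Type*} [MeasurableSpace Z]
    (D : Measure Z) [IsProbabilityMeasure D] (c : NNReal) (n : ℕ) (f : (Fin n → Z) → ℝ)
    (hf : AEMeasurable f (Measure.pi fun _ => D)) (M : ℝ) (hM : ∀ z, |f z| ≤ M)
    (hc : ∀ z i a, f (Function.update z i a) ≤ f z + c) :
    HasSubgaussianMGF (fun z => f z - ∫ z, f z ∂(Measure.pi fun _ => D)) (n * (c / 2) ^ 2)
      (Measure.pi fun _ => D) := by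
  induction n generalizing M with
  | zero =>
    have h : (fun z => f z - ∫ z, f z ∂(Measure.pi fun _ : Fin 0 => D)) = fun _ => 0 := by
      funext z
      have : ∀ z', f z' = f z := fun z' => by rw [Subsingleton.elim z' z]
      simp [this]
    rw [h]
    simp
  | succ n ih =>
    set P : Measure (Fin n → Z) := Measure.pi fun _ => D with hP
    set e := MeasurableEquiv.piFinSuccAbove (fun _ : Fin (n + 1) => Z) 0 with he
    have hmp : MeasurePreserving e (Measure.pi fun _ => D) (D.prod P) :=
      measurePreserving_piFinSuccAbove (fun _ : Fin (n + 1) => D) 0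
    set F : Z × (Fin n → Z) → ℝ := fun p => f (e.symm p) with hF
    have hFe : ∀ z, F (e z) = f z := fun z => by simp [hF]
    have hFcons : ∀ a w, F (a, w) = f (Fin.cons a w) := fun a w => by
      simp [hF, he, MeasurableEquiv.piFinSuccAbove, Fin.insertNthEquiv]
    have hFm : AEMeasurable F (D.prod P) :=
      hf.comp_quasiMeasurePreserving hmp.symm.quasiMeasurePreserving
    have hFint : Integrable F (D.prod P) :=
      Integrable.of_bound hFm.aestronglyMeasurable M (ae_of_all _ fun p => hM _)
    set g : Z → ℝ := fun a => ∫ w, F (a, w) ∂P with hg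
    have hgm : AEMeasurable g D := hFm.aestronglyMeasurable.integral_prod_right'.aemeasurable
    have hgood : ∀ᵐ a ∂D, AEMeasurable (fun w => F (a, w)) P :=
      hFm.aestronglyMeasurable.prodMk_left.mono fun a ha => ha.aemeasurable
    have hgM : ∀ a, |g a| ≤ M := fun a => by
      refine (norm_integral_le_of_norm_le_const (f := fun w => F (a, w)) (μ := P)
        (ae_of_all _ fun w => hM _)).trans_eq ?_
      simp
    have hmean : ∫ z, f z ∂(Measure.pi fun _ => D) = ∫ a, g a ∂D := by
      rw [← integral_prod _ hFint, ← hmp.integral_comp']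
      simp only [hFe]
    have hosc : ∀ a b, AEMeasurable (fun w => F (a, w)) P → AEMeasurable (fun w => F (b, w)) P →
        g a ≤ g b + c := by
      intro a b ha hb
      have hbi : Integrable (fun w => F (b, w)) P :=
        Integrable.of_bound hb.aestronglyMeasurable M (ae_of_all _ fun p => hM _)
      have hai : Integrable (fun w => F (a, w)) P :=
        Integrable.of_bound ha.aestronglyMeasurable M (ae_of_all _ fun p => hM _)
      have : g b + c = ∫ w, (F (b, w) + c) ∂P := by
        rw [integral_add hbi (integrable_const _)]; simp [hg]
      rw [this]
      refine integral_mono hai (hbi.add (integrable_const _)) fun w => ?_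
      have := hc (Fin.cons b w) 0 a
      rw [Fin.update_cons_zero] at this
      simpa [hFcons] using this
    obtain ⟨a₀, ha₀⟩ := hgood.exists
    -- Only those `a` with an a.e. measurable section enter the infimum: elsewhere the Bochner
    -- integral `g a` may take its default value 0, and the oscillation bound `hosc` is not
    -- available. Almost every `a` is good, which suffices for Hoeffding's lemma on an interval of
    -- length `c`.
    set lo : ℝ := sInf (g '' {a | AEMeasurable (fun w => F (a, w)) P}) with hlo
    have hbdd : BddBelow (g '' {a | AEMeasurable (fun w => F (a, w)) P}) :=
      ⟨-M, by rintro _ ⟨a, -, rfl⟩; exact (abs_le.1 (hgM a)).1⟩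
    have hIcc : ∀ᵐ a ∂D, g a ∈ Set.Icc lo (lo + c) := by
      filter_upwards [hgood] with a ha
      refine ⟨csInf_le hbdd ⟨a, ha, rfl⟩, ?_⟩
      rw [← sub_le_iff_le_add]
      refine le_csInf ⟨_, a₀, ha₀, rfl⟩ ?_
      rintro _ ⟨b, hb, rfl⟩
      rw [sub_le_iff_le_add]
      exact hosc a b ha hb
    have hgs : HasSubgaussianMGF (fun a => g a - ∫ a, g a ∂D) ((c / 2) ^ 2) D := by
      have := hasSubgaussianMGF_of_mem_Icc hgm hIcc
      simpa using this
    have hexpm : ∀ t : ℝ, AEStronglyMeasurable (fun p => Real.exp (t * (F p - ∫ a, g a ∂D)))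
        (D.prod P) := fun t =>
      (Real.measurable_exp.comp_aemeasurable ((hFm.sub_const _).const_mul t)).aestronglyMeasurable
    have hexpi : ∀ t : ℝ, Integrable (fun p => Real.exp (t * (F p - ∫ a, g a ∂D)))
        (D.prod P) := fun t => by
      refine Integrable.of_bound (hexpm t) (Real.exp (|t| * (M + |∫ a, g a ∂D|)))
        (ae_of_all _ fun p => ?_)
      rw [Real.norm_eq_abs, Real.abs_exp, Real.exp_le_exp]
      refine (le_abs_self _).trans ?_
      rw [abs_mul]
      gcongr
      exact (abs_sub _ _).trans (by gcongr; exact hM _)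
    have hcongr : ∀ t : ℝ, (fun z => Real.exp (t * (f z - ∫ z, f z ∂(Measure.pi fun _ => D))))
        = (fun p => Real.exp (t * (F p - ∫ a, g a ∂D))) ∘ e := fun t => by
      funext z
      simp only [Function.comp, hFe, hmean]
    refine ⟨fun t => ?_, fun t => ?_⟩
    · rw [hcongr t]
      exact hmp.integrable_comp_of_integrable (hexpi t)
    · rw [mgf, hcongr t]
      simp only [Function.comp_def]
      rw [hmp.integral_comp' (fun p => Real.exp (t * (F p - ∫ a, g a ∂D))),
        integral_prod _ (hexpi t)]
      -- Split F - EF = (F - g a) + (g a - EF). The induction hypothesis controls the first part on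
      -- the section at `a`, whose mean is `g a`; Hoeffding's lemma controls the second. The
      -- variance proxies add.
      have hK : ∀ᵐ a ∂D, ∫ w, Real.exp (t * (F (a, w) - ∫ a, g a ∂D)) ∂P
          ≤ Real.exp (t * (g a - ∫ a, g a ∂D)) * Real.exp (n * (c / 2) ^ 2 * t ^ 2 / 2) := by
        filter_upwards [hgood] with a ha
        have h1 := (ih (fun w => F (a, w)) ha M (fun w => hM _) (fun w i b => by
          have := hc (Fin.cons a w) i.succ b
          rw [← Fin.cons_update] at this
          simpa only [hFcons] using this)).mgf_le t
        have h2 : ∀ w, Real.exp (t * (F (a, w) - ∫ a, g a ∂D))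
            = Real.exp (t * (g a - ∫ a, g a ∂D)) * Real.exp (t * (F (a, w) - g a)) := fun w => by
          rw [← Real.exp_add]; congr 1; ring
        simp_rw [h2]
        rw [integral_const_mul]
        gcongr
        simpa [mgf] using h1
      refine (integral_mono_ae (hexpi t).integral_prod_left
        ((hgs.integrable_exp_mul t).mul_const _) hK).trans ?_
      rw [integral_mul_const]
      refine (mul_le_mul_of_nonneg_right (hgs.mgf_le t) (Real.exp_pos _).le).trans_eq ?_
      rw [← Real.exp_add]
      congr 1
      push_cast
      ring

/-! ### Gaussian absolute moments and contraction -/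

theorem integral_abs_gaussianReal : ∫ x, |x| ∂(gaussianReal 0 1) = √(2 / Real.pi) := by
  have h := integral_rpow_mul_exp_neg_mul_rpow (p := 2) (q := 1) (b := 1 / 2)
    (by norm_num) (by norm_num) (by norm_num)
  have h2 : (-(1 + 1) / 2 : ℝ) = -1 := by norm_num
  have h3 : ((1 + 1) / 2 : ℝ) = 1 := by norm_num
  rw [h2, h3, Real.rpow_neg_one, Real.Gamma_one] at h
  rw [integral_gaussianReal_eq_integral_smul one_ne_zero]
  have h4 : ∀ x : ℝ, gaussianPDFReal 0 1 x • |x|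
      = (√(2 * Real.pi))⁻¹ * (|x| ^ (1 : ℝ) * Real.exp (-(1 / 2) * |x| ^ (2 : ℝ))) := fun x => by
    have h5 : |x| ^ (2 : ℝ) = x ^ 2 := by
      rw [show (2 : ℝ) = ((2 : ℕ) : ℝ) by norm_num, Real.rpow_natCast, sq_abs]
    rw [gaussianPDFReal, smul_eq_mul, Real.rpow_one, h5]
    simp only [NNReal.coe_one, mul_one, sub_zero]
    rw [show -x ^ 2 / 2 = -(1 / 2) * x ^ 2 by ring]
    ring
  simp_rw [h4]
  rw [integral_const_mul,
    integral_comp_abs (f := fun x => x ^ (1 : ℝ) * Real.exp (-(1 / 2) * x ^ (2 : ℝ))), h]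
  have hpi := Real.pi_pos
  rw [Real.sqrt_div zero_le_two, Real.sqrt_mul zero_le_two]
  have := Real.sqrt_pos.2 hpi
  field_simp
  norm_num

section GaussianContraction

variable {K : Type*} [Fintype K]

theorem integrable_linearForm_gaussian (a : K → ℝ) :
    Integrable (fun w : K → ℝ => ∑ k, w k * a k) (Measure.pi fun _ => gaussianReal 0 1) := by
  refine integrable_finsetSum _ fun k _ => Integrable.mul_const ?_ _
  exact (measurePreserving_eval (fun _ : K => gaussianReal 0 1) k).integrable_comp_of_integrable
    (g := id) ((memLp_id_gaussianReal 1).integrable le_rfl)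

/-- The first absolute moment of a linear form in independent standard normal variables. -/
theorem integral_abs_linearForm_gaussian (a : K → ℝ) :
    ∫ w : K → ℝ, |∑ k, w k * a k| ∂(Measure.pi fun _ => gaussianReal 0 1)
      = √(2 / Real.pi) * √(∑ k, a k ^ 2) := by
  set E := EuclideanSpace ℝ K
  set L : StrongDual ℝ E := innerSL ℝ (WithLp.toLp 2 a) with hL
  have hLw : ∀ w : K → ℝ, L (WithLp.toLp 2 w) = ∑ k, w k * a k := fun w => by
    rw [hL, innerSL_apply_apply, EuclideanSpace.inner_toLp_toLp]
    simp [dotProduct]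
  have hnorm : ‖L‖ = √(∑ k, a k ^ 2) := by
    rw [hL, innerSL_apply_norm, EuclideanSpace.norm_eq]
    simp
  have h1 : ∫ w : K → ℝ, |∑ k, w k * a k| ∂(Measure.pi fun _ => gaussianReal 0 1)
      = ∫ y, |y| ∂((stdGaussian E).map L) := by
    rw [integral_map (by fun_prop) (by fun_prop), ← map_pi_eq_stdGaussian,
      integral_map (by fun_prop) (by fun_prop)]
    simp only [hLw]
  rw [h1, IsGaussian.map_eq_gaussianReal, integral_strongDual_stdGaussian,
    variance_dual_stdGaussian]
  have h2 := gaussianReal_map_const_mul (μ := 0) (v := 1) ‖L‖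
  rw [show gaussianReal 0 (‖L‖ ^ 2).toNNReal = (gaussianReal 0 1).map (‖L‖ * ·) by
    rw [h2]; congr 1
    · simp
    · ext; simp [sq_nonneg]]
  rw [integral_map (by fun_prop) (by fun_prop)]
  simp only [abs_mul]
  rw [integral_const_mul, integral_abs_gaussianReal, hnorm, abs_of_nonneg (Real.sqrt_nonneg _),
    mul_comm]

theorem measurePreserving_neg_gaussian :
    MeasurePreserving (fun w : K → ℝ => -w) (Measure.pi fun _ => gaussianReal 0 1)
      (Measure.pi fun _ => gaussianReal 0 1) := by
  refine measurePreserving_pi (fun _ : K => gaussianReal 0 1) (fun _ => gaussianReal 0 1)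
    (f := fun _ x => -x) fun _ => ⟨measurable_neg, ?_⟩
  rw [gaussianReal_map_neg, neg_zero]

theorem integrable_iSup {Ω T : Type*} [MeasurableSpace Ω] {P : Measure Ω} [Fintype T] [Nonempty T]
    {X : T → Ω → ℝ} (hX : ∀ t, Integrable (X t) P) : Integrable (fun ω => ⨆ t, X t ω) P := by
  refine Integrable.mono' (integrable_finsetSum Finset.univ fun t _ => (hX t).norm)
    (AEMeasurable.iSup fun t => (hX t).aemeasurable).aestronglyMeasurable
    (ae_of_all _ fun ω => ?_)
  obtain ⟨t, ht⟩ := exists_eq_ciSup_of_finite (f := fun t => X t ω)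
  rw [← ht]
  exact Finset.single_le_sum (f := fun t => ‖X t ω‖) (fun _ _ => norm_nonneg _) (Finset.mem_univ t)

theorem le_finite_iSup {T : Type*} [Finite T] (f : T → ℝ) (t : T) : f t ≤ ⨆ t, f t :=
  le_ciSup (Set.finite_range f).bddAbove t

/-- One step of the contraction principle: a random sign is replaced by a Gaussian linear form. -/
theorem average_sign_le_integral_gaussian {T : Type*} [Fintype T] [Nonempty T] (A h : T → ℝ)
    (u : T → K → ℝ)
    (hu : ∀ t t', |h t - h t'| ≤ √(2 / Real.pi) * √(∑ k, (u t k - u t' k) ^ 2)) :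
    ((⨆ t, (A t + h t)) + ⨆ t, (A t - h t)) / 2
      ≤ ∫ w : K → ℝ, ⨆ t, (A t + ∑ k, w k * u t k) ∂(Measure.pi fun _ => gaussianReal 0 1) := by
  set P : Measure (K → ℝ) := Measure.pi fun _ => gaussianReal 0 1
  set W : (K → ℝ) → ℝ := fun w => ⨆ t, (A t + ∑ k, w k * u t k) with hW
  have hWi : Integrable W P := integrable_iSup fun t =>
    (integrable_const _).add (integrable_linearForm_gaussian (u t))
  have hWneg : ∫ w, W (-w) ∂P = ∫ w, W w ∂P :=
    measurePreserving_neg_gaussian.integral_comp (Homeomorph.neg _).measurableEmbedding W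
  have hWin : Integrable (fun w => W (-w)) P :=
    measurePreserving_neg_gaussian.integrable_comp_of_integrable hWi
  obtain ⟨t, ht⟩ := exists_eq_ciSup_of_finite (f := fun t => A t + h t)
  obtain ⟨t', ht'⟩ := exists_eq_ciSup_of_finite (f := fun t => A t - h t)
  -- Evaluate one of `W w`, `W (-w)` at `t` and the other at `t'`; the better of the two pairings
  -- produces the absolute value. As `w` and `-w` have the same law, integration gives 2∫W on the
  -- right.
  have hpt : ∀ w, A t + A t' + |∑ k, w k * (u t k - u t' k)| ≤ W w + W (-w) := fun w => by
    have a1 := le_finite_iSup (fun t => A t + ∑ k, w k * u t k) t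
    have a2 := le_finite_iSup (fun t => A t + ∑ k, w k * u t k) t'
    have a3 := le_finite_iSup (fun t => A t + ∑ k, (-w) k * u t k) t
    have a4 := le_finite_iSup (fun t => A t + ∑ k, (-w) k * u t k) t'
    simp only [Pi.neg_apply, neg_mul, Finset.sum_neg_distrib] at a3 a4
    simp only [hW, Pi.neg_apply, neg_mul, Finset.sum_neg_distrib, mul_sub, Finset.sum_sub_distrib]
    rcases abs_cases (∑ k, w k * u t k - ∑ k, w k * u t' k) with ⟨h, -⟩ | ⟨h, -⟩ <;> rw [h] <;>
      linarith
  have hint := integral_mono (μ := P)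
    ((integrable_const (A t + A t')).add
      (integrable_linearForm_gaussian fun k => u t k - u t' k).abs) (hWi.add hWin) hpt
  simp only [Pi.add_apply] at hint
  rw [integral_add (integrable_const _) (integrable_linearForm_gaussian _).abs,
    integral_add hWi hWin, hWneg, integral_abs_linearForm_gaussian] at hint
  have hc : ∫ _, A t + A t' ∂P = A t + A t' := by simp
  rw [hc] at hint
  have := (le_abs_self _).trans (hu t t')
  rw [← ht, ← ht']
  linarith

/-- The sign attached to a boolean. -/
def sign (b : Bool) : ℝ := if b then 1 else -1

theorem abs_sign (b : Bool) : |sign b| = 1 := by cases b <;> simp [sign]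

theorem sum_boolVector_succ {n : ℕ} (φ : (Fin (n + 1) → Bool) → ℝ) :
    ∑ ε, φ ε = ∑ ε, φ (Fin.cons true ε) + ∑ ε, φ (Fin.cons false ε) := by
  rw [← (Fin.consEquiv fun _ => Bool).sum_comp, Fintype.sum_prod_type, Fintype.sum_bool]
  rfl

/-- **Contraction principle**: Rademacher averages of functions `h i` on a finite set that are
Lipschitz with respect to the Euclidean distance of the coefficients `u i` are bounded by
Gaussian averages. -/
theorem rademacher_le_gaussian {T : Type*} [Fintype T] [Nonempty T] {n : ℕ} (A : T → ℝ)
    (h : Fin n → T → ℝ) (u : Fin n → T → K → ℝ)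
    (hu : ∀ i t t', |h i t - h i t'| ≤ √(2 / Real.pi) * √(∑ k, (u i t k - u i t' k) ^ 2)) :
    (∑ ε : Fin n → Bool, ⨆ t, (A t + ∑ i, sign (ε i) * h i t)) / 2 ^ n
      ≤ ∫ w : Fin n → K → ℝ, ⨆ t, (A t + ∑ i, ∑ k, w i k * u i t k)
        ∂(Measure.pi fun _ => Measure.pi fun _ => gaussianReal 0 1) := by
  -- The offset `A` must vary: the induction hypothesis is used with the first signed term absorbed
  -- into it, the one-step lemma with the Gaussian terms already substituted.
  induction n generalizing A with
  | zero => simp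
  | succ n ih =>
    set γ : Measure (K → ℝ) := Measure.pi fun _ => gaussianReal 0 1 with hγ
    set P : Measure (Fin n → K → ℝ) := Measure.pi fun _ => γ with hP
    set e := MeasurableEquiv.piFinSuccAbove (fun _ : Fin (n + 1) => K → ℝ) 0 with he
    have hmp : MeasurePreserving e (Measure.pi fun _ => γ) (γ.prod P) :=
      measurePreserving_piFinSuccAbove (fun _ : Fin (n + 1) => γ) 0
    have hlin : ∀ (a : K → ℝ) (i : Fin n),
        Integrable (fun w : Fin n → K → ℝ => ∑ k, w i k * a k) P := fun a i =>
      (measurePreserving_eval (fun _ : Fin n => γ) i).integrable_comp_of_integrable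
        (integrable_linearForm_gaussian a)
    set G : (K → ℝ) × (Fin n → K → ℝ) → ℝ := fun p =>
      ⨆ t, (A t + ∑ k, p.1 k * u 0 t k + ∑ i : Fin n, ∑ k, p.2 i k * u i.succ t k) with hG
    have hGi : Integrable G (γ.prod P) := by
      refine integrable_iSup fun t => ((integrable_const _).add ?_).add
        (integrable_finsetSum _ fun i _ => ?_)
      · exact (integrable_linearForm_gaussian (u 0 t)).comp_fst P
      · exact (hlin (u i.succ t) i).comp_snd γ
    have hRHS : ∫ w : Fin (n + 1) → K → ℝ, ⨆ t, (A t + ∑ i, ∑ k, w i k * u i t k)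
        ∂(Measure.pi fun _ => γ) = ∫ w, ∫ v, G (v, w) ∂γ ∂P := by
      rw [← integral_prod_symm _ hGi, ← hmp.integral_comp']
      congr 1
      funext w
      simp only [hG, Fin.sum_univ_succ, add_assoc]
      rfl
    set Q : ℝ → (Fin n → K → ℝ) → ℝ := fun s w =>
      ⨆ t, (A t + s * h 0 t + ∑ i : Fin n, ∑ k, w i k * u i.succ t k) with hQ
    have hQi : ∀ s, Integrable (Q s) P := fun s => integrable_iSup fun t =>
      (integrable_const _).add (integrable_finsetSum _ fun i _ => hlin (u i.succ t) i)
    have hIH : ∀ b : Bool, (∑ ε : Fin n → Bool,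
        ⨆ t, (A t + ∑ i, sign ((Fin.cons b ε : Fin (n + 1) → Bool) i) * h i t)) / 2 ^ n
          ≤ ∫ w, Q (sign b) w ∂P := fun b => by
      have := ih (fun t => A t + sign b * h 0 t) (fun i => h i.succ) (fun i => u i.succ)
        fun i => hu i.succ
      simpa only [Fin.sum_univ_succ, Fin.cons_zero, Fin.cons_succ, ← add_assoc] using this
    have hstep : ∀ w, (Q 1 w + Q (-1) w) / 2 ≤ ∫ v, G (v, w) ∂γ := fun w => by
      have := average_sign_le_integral_gaussian
        (fun t => A t + ∑ i : Fin n, ∑ k, w i k * u i.succ t k) (h 0) (u 0) (hu 0)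
      have e1 : ∀ t, A t + 1 * h 0 t + ∑ i : Fin n, ∑ k, w i k * u i.succ t k
          = A t + ∑ i : Fin n, ∑ k, w i k * u i.succ t k + h 0 t := fun t => by ring
      have e2 : ∀ t, A t + -1 * h 0 t + ∑ i : Fin n, ∑ k, w i k * u i.succ t k
          = A t + ∑ i : Fin n, ∑ k, w i k * u i.succ t k - h 0 t := fun t => by ring
      simp only [hQ, hG, e1, e2]
      refine this.trans_eq ?_
      congr 1
      funext v
      congr 1
      funext t
      ring
    have hmono := integral_mono (((hQi 1).add (hQi (-1))).div_const 2)
      hGi.integral_prod_right hstep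
    have hspl : ∫ w, (Q 1 w + Q (-1) w) / 2 ∂P = (∫ w, Q 1 w ∂P + ∫ w, Q (-1) w ∂P) / 2 := by
      rw [integral_div, integral_add (hQi 1) (hQi (-1))]
    have h1 := hIH true
    have h2 := hIH false
    simp only [sign, if_true, Bool.false_eq_true, if_false] at h1 h2
    rw [hRHS, sum_boolVector_succ]
    refine le_trans ?_ (hspl.symm.le.trans hmono)
    rw [pow_succ, ← div_div, add_div]
    simp only [sign]
    linarith

end GaussianContraction

/-! ### Suprema of weighted sums and symmetrization -/

/-- The supremum over a class `H` of the weighted sums `∑ i, e i * h (z i)`. -/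
noncomputable def supSum {Z ι : Type*} [Fintype ι] (H : Set (Z → ℝ)) (e : ι → ℝ) (z : ι → Z) : ℝ :=
  ⨆ h : H, ∑ i, e i * h.1 (z i)

section SupSum

variable {Z ι κ : Type*} [Fintype ι] [Fintype κ] {H : Set (Z → ℝ)} {B : ℝ}

theorem abs_weightedSum_le (hB : ∀ h ∈ H, ∀ z, h z ∈ Set.Icc 0 B) (e : ι → ℝ) (z : ι → Z)
    {h : Z → ℝ} (hh : h ∈ H) : |∑ i, e i * h (z i)| ≤ (∑ i, |e i|) * B := by
  rw [Finset.sum_mul]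
  refine (Finset.abs_sum_le_sum_abs _ _).trans (Finset.sum_le_sum fun i _ => ?_)
  rw [abs_mul, abs_of_nonneg (hB h hh _).1]
  exact mul_le_mul_of_nonneg_left (hB h hh _).2 (abs_nonneg _)

theorem le_supSum (hB : ∀ h ∈ H, ∀ z, h z ∈ Set.Icc 0 B) (e : ι → ℝ) (z : ι → Z)
    {h : Z → ℝ} (hh : h ∈ H) : ∑ i, e i * h (z i) ≤ supSum H e z := by
  refine le_ciSup (f := fun h : H => ∑ i, e i * h.1 (z i)) ⟨(∑ i, |e i|) * B, ?_⟩ ⟨h, hh⟩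
  rintro _ ⟨h, rfl⟩
  exact (abs_le.1 (abs_weightedSum_le hB e z h.2)).2

theorem supSum_le (hH : H.Nonempty) {e : ι → ℝ} {z : ι → Z} {a : ℝ}
    (h : ∀ h ∈ H, ∑ i, e i * h (z i) ≤ a) : supSum H e z ≤ a := by
  have := hH.to_subtype
  exact ciSup_le fun g => h g.1 g.2

theorem abs_supSum_le (hH : H.Nonempty) (hB : ∀ h ∈ H, ∀ z, h z ∈ Set.Icc 0 B) (e : ι → ℝ)
    (z : ι → Z) : |supSum H e z| ≤ (∑ i, |e i|) * B := by
  obtain ⟨h, hh⟩ := hH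
  rw [abs_le]
  exact ⟨(abs_le.1 (abs_weightedSum_le hB e z hh)).1.trans (le_supSum hB e z hh),
    supSum_le ⟨h, hh⟩ fun g hg => (abs_le.1 (abs_weightedSum_le hB e z hg)).2⟩

theorem supSum_update_le [DecidableEq ι] (hH : H.Nonempty)
    (hB : ∀ h ∈ H, ∀ z, h z ∈ Set.Icc 0 B) (e : ι → ℝ) (z : ι → Z) (i : ι) (a : Z) :
    supSum H e (Function.update z i a) ≤ supSum H e z + |e i| * B := by
  refine supSum_le hH fun h hh => ?_
  have h1 := le_supSum hB e z hh
  have h2 : ∑ j, e j * h (Function.update z i a j) - ∑ j, e j * h (z j)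
      = e i * (h a - h (z i)) := by
    rw [← Finset.sum_sub_distrib, Finset.sum_eq_single i]
    · simp [mul_sub]
    · intro j _ hj
      simp [hj]
    · simp
  have h3 : e i * (h a - h (z i)) ≤ |e i| * B := by
    refine (le_abs_self _).trans ?_
    rw [abs_mul]
    refine mul_le_mul_of_nonneg_left ?_ (abs_nonneg _)
    have := hB h hh a
    have := hB h hh (z i)
    simp only [Set.mem_Icc] at *
    rw [abs_le]
    constructor <;> linarith
  linarith

/-- Boundedness and nonemptiness keep the real supremum away from its default value. This is the
link to `IsMeasurableClass`, which is phrased in `EReal`. -/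
theorem coe_supSum (hH : H.Nonempty) (hB : ∀ h ∈ H, ∀ z, h z ∈ Set.Icc 0 B) (e : ι → ℝ)
    (z : ι → Z) : ((supSum H e z : ℝ) : EReal) = ⨆ h ∈ H, ((∑ i, e i * h (z i) : ℝ) : EReal) := by
  refine le_antisymm ?_ (iSup₂_le fun h hh => EReal.coe_le_coe_iff.2 (le_supSum hB e z hh))
  refine EReal.le_of_forall_lt_iff_le.1 fun r hr => ?_
  refine EReal.coe_le_coe_iff.2 (supSum_le hH fun h hh => ?_)
  refine EReal.coe_le_coe_iff.1 (le_trans ?_ hr.le)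
  exact le_iSup₂ (f := fun (h : Z → ℝ) (_ : h ∈ H) => ((∑ i, e i * h (z i) : ℝ) : EReal)) h hh

theorem supSum_comp_equiv (σ : ι ≃ κ) (e : κ → ℝ) (z : κ → Z) :
    supSum H (e ∘ σ) (z ∘ σ) = supSum H e z := by
  unfold supSum
  congr 1
  funext h
  exact σ.sum_comp fun k => e k * h.1 (z k)

theorem supSum_sumElim_le (hH : H.Nonempty) (hB : ∀ h ∈ H, ∀ z, h z ∈ Set.Icc 0 B) (e : ι → ℝ)
    (e' : κ → ℝ) (z : ι → Z) (z' : κ → Z) :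
    supSum H (Sum.elim e e') (Sum.elim z z') ≤ supSum H e z + supSum H e' z' := by
  refine supSum_le hH fun h hh => ?_
  rw [Fintype.sum_sum_type]
  exact add_le_add (le_supSum hB e z hh) (le_supSum hB e' z' hh)

variable [MeasurableSpace Z] {D : Measure Z} [IsProbabilityMeasure D]

theorem aemeasurable_supSum (hmeas : IsMeasurableClass D H) (hH : H.Nonempty)
    (hB : ∀ h ∈ H, ∀ z, h z ∈ Set.Icc 0 B) (e : ι → ℝ) :
    AEMeasurable (supSum H e) (Measure.pi fun _ : ι => D) := by
  set σ := Fintype.equivFin ι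
  have h1 : AEMeasurable (supSum H (e ∘ σ.symm)) (Measure.pi fun _ => D) := by
    refine (hmeas _ (e ∘ σ.symm)).ereal_toReal.congr (ae_of_all _ fun z => ?_)
    simp only
    rw [← coe_supSum hH hB, EReal.toReal_coe]
  have hmp := measurePreserving_piCongrLeft (fun _ => D) σ
  refine (h1.comp_quasiMeasurePreserving hmp.quasiMeasurePreserving).congr
    (ae_of_all _ fun z => ?_)
  have h2 : (MeasurableEquiv.piCongrLeft (fun _ => Z) σ) z = z ∘ σ.symm := by
    funext k
    obtain ⟨i, rfl⟩ := σ.surjective k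
    rw [MeasurableEquiv.coe_piCongrLeft, Equiv.piCongrLeft_apply_apply]
    simp
  rw [Function.comp_apply, h2, supSum_comp_equiv σ.symm]

theorem integrable_supSum (hmeas : IsMeasurableClass D H) (hH : H.Nonempty)
    (hB : ∀ h ∈ H, ∀ z, h z ∈ Set.Icc 0 B) (e : ι → ℝ) :
    Integrable (supSum H e) (Measure.pi fun _ : ι => D) :=
  Integrable.of_bound (aemeasurable_supSum hmeas hH hB e).aestronglyMeasurable _
    (ae_of_all _ fun z => abs_supSum_le hH hB e z)

/-- A power of a single measure is invariant under permutation of coordinates, so permuting the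
weights amounts to permuting the i.i.d. points. -/
theorem integral_supSum_comp_perm (σ : Equiv.Perm ι) (e : ι → ℝ) :
    ∫ z, supSum H (e ∘ σ) z ∂(Measure.pi fun _ : ι => D)
      = ∫ z, supSum H e z ∂(Measure.pi fun _ : ι => D) := by
  have hmp := measurePreserving_piCongrLeft (fun _ : ι => D) σ
  rw [← hmp.integral_comp' (fun z => supSum H e z)]
  congr 1
  funext z
  have h2 : (MeasurableEquiv.piCongrLeft (fun _ => Z) σ) z ∘ σ = z := by
    funext k
    rw [Function.comp_apply, MeasurableEquiv.coe_piCongrLeft, Equiv.piCongrLeft_apply_apply]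
  conv_lhs => rw [← h2]
  rw [supSum_comp_equiv σ]

theorem measurePreserving_sumElim :
    MeasurePreserving (fun p : (ι → Z) × (κ → Z) => (Sum.elim p.1 p.2 : ι ⊕ κ → Z))
      ((Measure.pi fun _ => D).prod (Measure.pi fun _ => D)) (Measure.pi fun _ => D) := by
  have h := measurePreserving_sumPiEquivProdPi_symm (X := fun _ : ι ⊕ κ => Z) (fun _ => D)
  have h2 : ⇑(MeasurableEquiv.sumPiEquivProdPi (fun _ : ι ⊕ κ => Z)).symm
      = fun p : (ι → Z) × (κ → Z) => (Sum.elim p.1 p.2 : ι ⊕ κ → Z) := by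
    funext p k
    cases k <;> rfl
  rwa [h2] at h

theorem integral_supSum_sumElim (hmeas : IsMeasurableClass D H) (hH : H.Nonempty)
    (hB : ∀ h ∈ H, ∀ z, h z ∈ Set.Icc 0 B) (e : ι ⊕ κ → ℝ) :
    ∫ p : (ι → Z) × (κ → Z), supSum H e (Sum.elim p.1 p.2)
        ∂((Measure.pi fun _ => D).prod (Measure.pi fun _ => D))
      = ∫ z, supSum H e z ∂(Measure.pi fun _ => D) := by
  have hmp := measurePreserving_sumElim (ι := ι) (κ := κ) (D := D)
  rw [← hmp.map_eq, integral_map hmp.measurable.aemeasurable]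
  rw [hmp.map_eq]
  exact (aemeasurable_supSum hmeas hH hB e).aestronglyMeasurable

/-- The permutation that exchanges the two copies of `i` where `ε i` is false. -/
def exchange {n : ℕ} (ε : Fin n → Bool) : Equiv.Perm (Fin n ⊕ Fin n) :=
  Function.Involutive.toPerm
    (Sum.elim (fun i => if ε i then Sum.inl i else Sum.inr i)
      (fun i => if ε i then Sum.inr i else Sum.inl i))
    (by rintro (i | i) <;> cases h : ε i <;> simp [h])

theorem coe_exchange {n : ℕ} (ε : Fin n → Bool) :
    ⇑(exchange ε) = Sum.elim (fun i => if ε i then Sum.inl i else Sum.inr i)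
      (fun i => if ε i then Sum.inr i else Sum.inl i) :=
  rfl

theorem elim_comp_exchange {n : ℕ} (ε : Fin n → Bool) :
    (Sum.elim (fun _ => -1) (fun _ => 1) : Fin n ⊕ Fin n → ℝ) ∘ exchange ε
      = Sum.elim (fun i => sign (!ε i)) (fun i => sign (ε i)) := by
  funext k
  rw [Function.comp_apply, coe_exchange]
  rcases k with i | i <;> cases h : ε i <;> simp [sign, h]

/-- Twice the sum over all sign vectors of the expected suprema of the signed sums bounds the
expected supremum of the differences of two independent samples. -/
theorem symmetrization (hmeas : IsMeasurableClass D H) (hH : H.Nonempty)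
    (hB : ∀ h ∈ H, ∀ z, h z ∈ Set.Icc 0 B) (n : ℕ) :
    ∫ z, supSum H (Sum.elim (fun _ => -1) (fun _ => 1) : Fin n ⊕ Fin n → ℝ) z
        ∂(Measure.pi fun _ => D)
      ≤ 2 * ∫ S : Fin n → Z, (∑ ε : Fin n → Bool, supSum H (fun i => sign (ε i)) S) / 2 ^ n
        ∂(Measure.pi fun _ => D) := by
  set I := ∫ z, supSum H (Sum.elim (fun _ => -1) (fun _ => 1) : Fin n ⊕ Fin n → ℝ) z
    ∂(Measure.pi fun _ => D) with hI
  set μ : Measure (Fin n → Z) := Measure.pi fun _ => D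
  have key : ∀ ε : Fin n → Bool, I ≤ ∫ S, supSum H (fun i => sign (!ε i)) S ∂μ
      + ∫ S, supSum H (fun i => sign (ε i)) S ∂μ := fun ε => by
    have i1 := (integrable_supSum hmeas hH hB fun i => sign (!ε i)).comp_fst μ
    have i2 := (integrable_supSum hmeas hH hB fun i => sign (ε i)).comp_snd μ
    have i3 : Integrable (fun p : (Fin n → Z) × (Fin n → Z) =>
        supSum H (Sum.elim (fun i => sign (!ε i)) (fun i => sign (ε i))) (Sum.elim p.1 p.2))
        (μ.prod μ) :=
      measurePreserving_sumElim.integrable_comp_of_integrable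
        (integrable_supSum hmeas hH hB _)
    -- Exchanging S_i with S'_i where `ε i` is false preserves the law and turns the weights (-1, 1)
    -- into (-ε, ε); subadditivity of the supremum then separates the two samples.
    rw [hI, ← integral_supSum_comp_perm (exchange ε), elim_comp_exchange,
      ← integral_supSum_sumElim hmeas hH hB]
    refine (integral_mono i3 (i1.add i2) fun p => supSum_sumElim_le hH hB _ _ _ _).trans_eq ?_
    rw [integral_add' i1 i2, integral_fun_fst (fun S => supSum H (fun i => sign (!ε i)) S),
      integral_fun_snd (fun S => supSum H (fun i => sign (ε i)) S)]
    simp [μ]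
  have hsum := Finset.sum_le_sum fun (ε : Fin n → Bool) (_ : ε ∈ Finset.univ) => key ε
  rw [Finset.sum_add_distrib] at hsum
  -- Negation permutes the sign vectors, so both halves have the same total; this is the factor 2.
  have hflip : ∑ ε : Fin n → Bool, ∫ S, supSum H (fun i => sign (!ε i)) S ∂μ
      = ∑ ε : Fin n → Bool, ∫ S, supSum H (fun i => sign (ε i)) S ∂μ :=
    (Equiv.arrowCongr (Equiv.refl (Fin n)) Equiv.boolNot).sum_comp
      fun ε => ∫ S, supSum H (fun i => sign (ε i)) S ∂μ
  rw [hflip] at hsum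
  simp only [Finset.sum_const, Finset.card_univ, Fintype.card_fun, Fintype.card_bool,
    Fintype.card_fin, nsmul_eq_mul, Nat.cast_pow, Nat.cast_ofNat] at hsum
  rw [integral_div, integral_finsetSum _ fun ε _ => integrable_supSum hmeas hH hB _]
  have : (0 : ℝ) < 2 ^ n := by positivity
  rw [← mul_div_assoc, le_div_iff₀ this]
  linarith

end SupSum

/-! ### High-probability bounds -/

section Deviation

variable {Z : Type*} [MeasurableSpace Z] {D : Measure Z} [IsProbabilityMeasure D]

/-- With variance proxy nB²/4, the level B√(n log(2/δ)/2) makes the sub-Gaussian exponent exactly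
-log(2/δ). -/
theorem measureReal_mean_deviation_le {n : ℕ} (hn : 0 < n) {B : ℝ} (hB : 0 < B)
    {f : (Fin n → Z) → ℝ} (hf : AEMeasurable f (Measure.pi fun _ => D)) {M : ℝ}
    (hM : ∀ z, |f z| ≤ M) (hc : ∀ z i a, f (Function.update z i a) ≤ f z + B)
    {δ : ℝ} (hδ₀ : 0 < δ) (hδ₁ : δ < 1) :
    (Measure.pi fun _ => D).real {S | B * √(n * Real.log (2 / δ) / 2)
        ≤ f S - ∫ z, f z ∂(Measure.pi fun _ => D)} ≤ δ / 2 := by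
  have h := hasSubgaussianMGF_pi_of_bounded_differences D B.toNNReal n f hf M hM fun z i a => by
    rw [Real.coe_toNNReal B hB.le]
    exact hc z i a
  refine (h.measure_ge_le (by positivity)).trans_eq ?_
  have hlog : 0 ≤ Real.log (2 / δ) := Real.log_nonneg (by rw [le_div_iff₀ hδ₀]; linarith)
  have hn' : (0 : ℝ) < n := by exact_mod_cast hn
  have h1 : -(B * √(n * Real.log (2 / δ) / 2)) ^ 2
      / (2 * ((n * (B.toNNReal / 2) ^ 2 : NNReal) : ℝ)) = -Real.log (2 / δ) := by
    rw [mul_pow, Real.sq_sqrt (by positivity)]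
    push_cast
    rw [Real.coe_toNNReal B hB.le]
    field_simp
  rw [h1, Real.exp_neg, Real.exp_log (by positivity), inv_div]

/-- **Uniform deviation bound** in terms of the empirical Rademacher average of the class. -/
theorem exists_uniform_deviation_bound {n : ℕ} (hn : 0 < n) {H : Set (Z → ℝ)} (hH : H.Nonempty)
    (hHm : ∀ h ∈ H, Measurable h) (hmeas : IsMeasurableClass D H) {B : ℝ} (hB : 0 < B)
    (hbdd : ∀ h ∈ H, ∀ z, h z ∈ Set.Icc 0 B) {δ : ℝ} (hδ₀ : 0 < δ) (hδ₁ : δ < 1) :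
    ∃ A : Set (Fin n → Z), MeasurableSet A ∧
      ENNReal.ofReal (1 - δ) ≤ Measure.pi (fun _ : Fin n => D) A ∧
      ∀ S ∈ A, ∀ h ∈ H, n * ∫ z, h z ∂D - ∑ i, h (S i) ≤
        2 * ((∑ ε : Fin n → Bool, supSum H (fun i => sign (ε i)) S) / 2 ^ n)
          + 3 * (B * √(n * Real.log (2 / δ) / 2)) := by
  set μ : Measure (Fin n → Z) := Measure.pi fun _ => D with hμ
  set w : Fin n ⊕ Fin n → ℝ := Sum.elim (fun _ => -1) (fun _ => 1) with hw
  set t : ℝ := B * √(n * Real.log (2 / δ) / 2) with ht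
  set V : (Fin n → Z) → ℝ := fun S =>
    (∑ ε : Fin n → Bool, supSum H (fun i => sign (ε i)) S) / 2 ^ n with hV
  set c : ℝ := (∑ k, |w k|) * B with hc
  have hWc : ∀ S S' : Fin n → Z, |supSum H w (Sum.elim S S')| ≤ c := fun S S' =>
    abs_supSum_le hH hbdd w _
  -- The shift by `c` makes the integrand nonnegative, so that a lower Lebesgue integral can be
  -- used. It is monotone without measurability, so the bounded-difference property holds at every
  -- `S`, even where the section is not measurable.
  set U : (Fin n → Z) → ℝ≥0∞ := fun S =>
    ∫⁻ S', ENNReal.ofReal (supSum H w (Sum.elim S S') + c) ∂μ with hU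
  have hUle : ∀ S, U S ≤ ENNReal.ofReal (2 * c) := fun S => by
    refine (lintegral_mono fun S' => ENNReal.ofReal_le_ofReal
      (show _ ≤ 2 * c by linarith [(abs_le.1 (hWc S S')).2])).trans_eq ?_
    simp
  have hUtop : ∀ S, U S ≠ ⊤ := fun S => ((hUle S).trans_lt ENNReal.ofReal_lt_top).ne
  have hc0 : 0 ≤ c := by positivity
  set Ψ : (Fin n → Z) → ℝ := fun S => (U S).toReal - c with hΨ
  have hWm : AEMeasurable (fun p : (Fin n → Z) × (Fin n → Z) => supSum H w (Sum.elim p.1 p.2))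
      (μ.prod μ) :=
    (aemeasurable_supSum hmeas hH hbdd w).comp_quasiMeasurePreserving
      measurePreserving_sumElim.quasiMeasurePreserving
  have hΨm : AEMeasurable Ψ μ :=
    ((hWm.add_const c).ennreal_ofReal.lintegral_prod_right').ennreal_toReal.sub_const c
  have hΨM : ∀ S, |Ψ S| ≤ c := fun S => by
    have h1 := ENNReal.toReal_le_of_le_ofReal (by linarith) (hUle S)
    have h2 : 0 ≤ (U S).toReal := ENNReal.toReal_nonneg
    rw [abs_le]
    constructor <;> simp only [hΨ] <;> linarith
  have hΨup : ∀ S i a, Ψ (Function.update S i a) ≤ Ψ S + B := fun S i a => by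
    have h1 : U (Function.update S i a) ≤ U S + ENNReal.ofReal B := by
      have : U S + ENNReal.ofReal B
          = ∫⁻ S', (ENNReal.ofReal (supSum H w (Sum.elim S S') + c) + ENNReal.ofReal B) ∂μ := by
        rw [lintegral_add_right _ measurable_const]
        simp [hU]
      rw [this]
      refine lintegral_mono fun S' => ?_
      rw [← ENNReal.ofReal_add (by linarith [(abs_le.1 (hWc S S')).1]) hB.le]
      refine ENNReal.ofReal_le_ofReal ?_
      have h2 := supSum_update_le hH hbdd w (Sum.elim S S') (Sum.inl i) a
      rw [Sum.update_elim_inl] at h2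
      have h3 : |w (Sum.inl i)| = 1 := by simp [hw]
      rw [h3] at h2
      linarith
    have h2 := ENNReal.toReal_mono (ENNReal.add_ne_top.2 ⟨hUtop S, ENNReal.ofReal_ne_top⟩) h1
    rw [ENNReal.toReal_add (hUtop S) ENNReal.ofReal_ne_top, ENNReal.toReal_ofReal hB.le] at h2
    simp only [hΨ]
    linarith
  have hΨgap : ∀ S, ∀ h ∈ H, n * ∫ z, h z ∂D - ∑ i, h (S i) ≤ Ψ S := fun S h hh => by
    have hhi : Integrable h D := Integrable.of_bound (hHm h hh).aestronglyMeasurable B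
      (ae_of_all _ fun z => by
        rw [Real.norm_eq_abs, abs_of_nonneg (hbdd h hh z).1]; exact (hbdd h hh z).2)
    have hev : ∀ i : Fin n, Integrable (fun S' : Fin n → Z => h (S' i)) μ := fun i =>
      (measurePreserving_eval (fun _ : Fin n => D) i).integrable_comp_of_integrable hhi
    have hev' : ∀ i : Fin n, ∫ S', h (S' i) ∂μ = ∫ z, h z ∂D := fun i => by
      have hmp := measurePreserving_eval (fun _ : Fin n => D) i
      conv_rhs => rw [← hmp.map_eq]
      rw [integral_map hmp.measurable.aemeasurable (hHm h hh).aestronglyMeasurable]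
    have hsplit : ∀ S' : Fin n → Z, ∑ k, w k * h ((Sum.elim S S' : Fin n ⊕ Fin n → Z) k)
        = ∑ i, h (S' i) - ∑ i, h (S i) := fun S' => by
      rw [Fintype.sum_sum_type]
      simp only [hw, Sum.elim_inl, Sum.elim_inr, neg_mul, one_mul, Finset.sum_neg_distrib]
      ring
    have hle : ∀ S' : Fin n → Z, ∑ i, h (S' i) - ∑ i, h (S i) ≤ supSum H w (Sum.elim S S') :=
      fun S' => (hsplit S').symm.le.trans (le_supSum hbdd w _ hh)
    have hge : ∀ S' : Fin n → Z, 0 ≤ ∑ i, h (S' i) - ∑ i, h (S i) + c := fun S' => by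
      have := (abs_le.1 (abs_weightedSum_le hbdd w (Sum.elim S S') hh)).1
      rw [hsplit] at this
      linarith
    have hs : Integrable (fun S' : Fin n → Z => ∑ i, h (S' i)) μ :=
      integrable_finsetSum _ fun i _ => hev i
    have hs' : Integrable (fun S' : Fin n → Z => ∑ i, h (S' i) - ∑ i, h (S i)) μ :=
      hs.sub (integrable_const _)
    have hSi : Integrable (fun S' : Fin n → Z => ∑ i, h (S' i) - ∑ i, h (S i) + c) μ :=
      hs'.add (integrable_const _)
    have h1 : ∫ S', (∑ i, h (S' i) - ∑ i, h (S i) + c) ∂μ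
        = n * ∫ z, h z ∂D - ∑ i, h (S i) + c := by
      rw [integral_add hs' (integrable_const _), integral_sub hs (integrable_const _), integral_finsetSum _ fun i _ => hev i]
      simp [hev']
    have h2 : ENNReal.ofReal (n * ∫ z, h z ∂D - ∑ i, h (S i) + c) ≤ U S := by
      rw [← h1, ofReal_integral_eq_lintegral_ofReal hSi (ae_of_all _ hge)]
      exact lintegral_mono fun S' => ENNReal.ofReal_le_ofReal (by linarith [hle S'])
    have h3 := (ENNReal.ofReal_le_iff_le_toReal (hUtop S)).1 h2
    simp only [hΨ]
    linarith
  -- For almost every `S` the section is integrable, and there `Ψ S` is the Bochner integral of the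
  -- unshifted supremum.
  have hΨmean : ∫ S, Ψ S ∂μ = ∫ z, supSum H w z ∂(Measure.pi fun _ => D) := by
    have hWi : Integrable (fun p : (Fin n → Z) × (Fin n → Z) => supSum H w (Sum.elim p.1 p.2))
        (μ.prod μ) := Integrable.of_bound hWm.aestronglyMeasurable c
          (ae_of_all _ fun p => hWc _ _)
    rw [← integral_supSum_sumElim hmeas hH hbdd, integral_prod _ hWi]
    refine integral_congr_ae ?_
    filter_upwards [hWi.prod_right_ae] with S hS
    have h1 : Integrable (fun S' => supSum H w (Sum.elim S S') + c) μ :=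
      hS.add (integrable_const c)
    have h2 := ofReal_integral_eq_lintegral_ofReal h1
      (ae_of_all _ fun S' => by
        simp only [Pi.zero_apply]
        linarith [(abs_le.1 (hWc S S')).1])
    have h3 : 0 ≤ ∫ S', (supSum H w (Sum.elim S S') + c) ∂μ :=
      integral_nonneg fun S' => by
        simp only [Pi.zero_apply]
        linarith [(abs_le.1 (hWc S S')).1]
    simp only [hΨ, hU]
    rw [← h2, ENNReal.toReal_ofReal h3, integral_add hS (integrable_const c)]
    simp
  have hVm : AEMeasurable V μ :=
    (Finset.aemeasurable_fun_sum _ fun ε _ => aemeasurable_supSum hmeas hH hbdd _).div_const _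
  have hpow : (0 : ℝ) < 2 ^ n := by positivity
  have hcard : (Finset.univ : Finset (Fin n → Bool)).card = 2 ^ n := by simp
  have hVM : ∀ S, |V S| ≤ n * B := fun S => by
    simp only [hV]
    rw [abs_div, abs_of_pos hpow, div_le_iff₀ hpow]
    refine (Finset.abs_sum_le_sum_abs _ _).trans ?_
    refine (Finset.sum_le_card_nsmul _ _ (n * B) fun ε _ => ?_).trans_eq ?_
    · refine (abs_supSum_le hH hbdd _ S).trans_eq ?_
      simp [abs_sign]
    · rw [hcard, nsmul_eq_mul]
      push_cast
      ring
  have hVup : ∀ S i a, V (Function.update S i a) ≤ V S + B := fun S i a => by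
    simp only [hV]
    rw [div_add' _ _ _ hpow.ne']
    refine div_le_div_of_nonneg_right ?_ hpow.le
    have : ∑ ε : Fin n → Bool, supSum H (fun i => sign (ε i)) S + B * 2 ^ n
        = ∑ ε : Fin n → Bool, (supSum H (fun i => sign (ε i)) S + B) := by
      rw [Finset.sum_add_distrib, Finset.sum_const, hcard, nsmul_eq_mul]
      push_cast
      ring
    rw [this]
    refine Finset.sum_le_sum fun ε _ => ?_
    have := supSum_update_le hH hbdd (fun i => sign (ε i)) S i a
    rwa [abs_sign, one_mul] at this
  have hVup' : ∀ S i a, -V (Function.update S i a) ≤ -V S + B := fun S i a => by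
    have := hVup (Function.update S i a) i (S i)
    rw [Function.update_idem, Function.update_eq_self] at this
    linarith
  have hdev₁ := measureReal_mean_deviation_le hn hB hΨm hΨM hΨup hδ₀ hδ₁
  have hdev₂ := measureReal_mean_deviation_le hn hB hVm.neg (M := n * B)
    (fun S => by rw [Pi.neg_apply, abs_neg]; exact hVM S) hVup' hδ₀ hδ₁
  set E₁ : Set (Fin n → Z) := {S | t ≤ Ψ S - ∫ z, Ψ z ∂μ}
  set E₂ : Set (Fin n → Z) := {S | t ≤ (-V) S - ∫ z, (-V) z ∂μ} with hE₂
  have hE : μ.real (E₁ ∪ E₂) ≤ δ :=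
    (measureReal_union_le _ _).trans (by linarith)
  refine ⟨(toMeasurable μ (E₁ ∪ E₂))ᶜ, (measurableSet_toMeasurable _ _).compl, ?_, ?_⟩
  · rw [prob_compl_eq_one_sub (measurableSet_toMeasurable _ _), measure_toMeasurable,
      ENNReal.ofReal_sub _ hδ₀.le, ENNReal.ofReal_one]
    refine tsub_le_tsub_left ?_ _
    rw [← ofReal_measureReal]
    exact ENNReal.ofReal_le_ofReal hE
  · intro S hS h hh
    have hS' : S ∉ E₁ ∪ E₂ := fun h => hS (subset_toMeasurable _ _ h)
    have h1 : Ψ S - ∫ z, Ψ z ∂μ < t := not_le.1 fun h => hS' (Or.inl h)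
    have h2 : (-V) S - ∫ z, (-V) z ∂μ < t := not_le.1 fun h => hS' (Or.inr h)
    rw [integral_neg' V, Pi.neg_apply] at h2
    have h3 := symmetrization hmeas hH hbdd n
    rw [← hw, ← hΨmean] at h3
    have h4 := hΨgap S h hh
    -- Ψ < EΨ + t ≤ 2 EV + t < 2(V + t) + t.
    linarith

end Deviation

/-! ### Lower bounds for Gaussian complexities -/

/-- `Y` need not be measurable: `∫⁻` is monotone for all functions, passing to `Y` raises the
positive part and lowers the negative part, and both parts of `U` have finite integral. -/
theorem coe_integral_le_extExp {Ω : Type*} [MeasurableSpace Ω] {P : Measure Ω} {U : Ω → ℝ}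
    (hU : Integrable U P) {Y : Ω → EReal} (h : ∀ ω, (U ω : EReal) ≤ Y ω) :
    ((∫ ω, U ω ∂P : ℝ) : EReal) ≤ extExp P Y := by
  have hfin : ∀ V : Ω → ℝ, Integrable V P → ∫⁻ ω, ENNReal.ofReal (V ω) ∂P ≠ ⊤ := fun V hV =>
    hV.lintegral_lt_top.ne
  rw [integral_eq_lintegral_pos_part_sub_lintegral_neg_part hU, EReal.coe_sub,
    EReal.coe_ennreal_toReal (hfin U hU), EReal.coe_ennreal_toReal (hfin (fun ω => -U ω) hU.neg)]
  refine EReal.sub_le_sub (EReal.coe_ennreal_le_coe_ennreal_iff.2 (lintegral_mono fun ω => ?_))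
    (EReal.coe_ennreal_le_coe_ennreal_iff.2 (lintegral_mono fun ω => ?_))
  · exact EReal.toENNReal_le_toENNReal (h ω)
  · have := EReal.toENNReal_le_toENNReal (EReal.neg_le_neg_iff.2 (h ω))
    rwa [← EReal.coe_neg] at this

/-- Any family of distinct coordinates of a doubly indexed i.i.d. array is an i.i.d. family. -/
theorem measurePreserving_subarray {ι κ ι' E : Type*} [Fintype ι] [Fintype κ] [Fintype ι']
    [MeasurableSpace E] (ν : Measure E) [IsProbabilityMeasure ν] {φ : ι' → ι × κ}
    (hφ : Function.Injective φ) :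
    MeasurePreserving (fun (w : ι → κ → E) p => w (φ p).1 (φ p).2)
      (Measure.pi fun _ => Measure.pi fun _ => ν) (Measure.pi fun _ => ν) := by
  have h1 : MeasurePreserving (fun (w : ι → κ → E) (p : ι × κ) => w p.1 p.2)
      (Measure.pi fun _ => Measure.pi fun _ => ν) (Measure.pi fun _ => ν) := by
    have hm : Measurable fun (w : ι → κ → E) (p : ι × κ) => w p.1 p.2 := by fun_prop
    refine ⟨hm, (Measure.pi_eq fun s hs => ?_).symm⟩
    rw [Measure.map_apply hm (MeasurableSet.univ_pi hs)]
    have : (fun (w : ι → κ → E) (p : ι × κ) => w p.1 p.2) ⁻¹' Set.univ.pi s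
        = Set.univ.pi fun i => Set.univ.pi fun k => s (i, k) := by
      ext w
      simp [Set.mem_pi]
    rw [this, Measure.pi_pi, Fintype.prod_prod_type]
    simp only [Measure.pi_pi]
  have h2 : MeasurePreserving (fun (w : ι × κ → E) (p : ι') => w (φ p))
      (Measure.pi fun _ => ν) (Measure.pi fun _ => ν) := by
    have hi := (iIndepFun_pi (μ := fun _ : ι × κ => ν) (X := fun _ x => x)
      fun _ => aemeasurable_id).precomp hφ
    rw [iIndepFun_iff_map_fun_eq_pi_map fun i => (measurable_pi_apply _).aemeasurable] at hi
    refine ⟨by fun_prop, hi.trans ?_⟩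
    congr 1
    funext p
    exact (measurePreserving_eval (fun _ : ι × κ => ν) (φ p)).map_eq
  exact h2.comp h1

/-- The expected maximum of the Gaussian averages of finitely many members of a class, computed
from some entries of a Gaussian array, is at most the Gaussian complexity of the class. -/
theorem coe_integral_iSup_le_gaussianComplexity {ι κ ι' T Z : Type*} [Fintype ι] [Fintype κ]
    [Fintype ι'] [Fintype T] [Nonempty T] {φ : ι' → ι × κ} (hφ : Function.Injective φ)
    {H : Set (Z → ℝ)} (z : ι' → Z) (h : T → Z → ℝ) (hh : ∀ t, h t ∈ H) :
    Integrable (fun w : ι → κ → ℝ => ⨆ t, 1 / (Fintype.card ι' : ℝ) *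
        ∑ p, w (φ p).1 (φ p).2 * h t (z p))
        (Measure.pi fun _ => Measure.pi fun _ => gaussianReal 0 1) ∧
      ((∫ w : ι → κ → ℝ, ⨆ t, 1 / (Fintype.card ι' : ℝ) * ∑ p, w (φ p).1 (φ p).2 * h t (z p)
        ∂(Measure.pi fun _ => Measure.pi fun _ => gaussianReal 0 1) : ℝ) : EReal)
      ≤ gaussianComplexity z H := by
  have hmp := measurePreserving_subarray (gaussianReal 0 1) hφ
  have hU : Integrable (fun g : ι' → ℝ => ⨆ t, 1 / (Fintype.card ι' : ℝ) * ∑ p, g p * h t (z p))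
      (Measure.pi fun _ => gaussianReal 0 1) :=
    integrable_iSup fun t => (integrable_linearForm_gaussian fun p => h t (z p)).const_mul _
  refine ⟨hmp.integrable_comp_of_integrable hU, ?_⟩
  have h1 := integral_map (μ := Measure.pi fun _ => Measure.pi fun _ => gaussianReal 0 1)
    hmp.measurable.aemeasurable (hmp.map_eq ▸ hU.aestronglyMeasurable)
  rw [← h1, hmp.map_eq]
  refine coe_integral_le_extExp hU fun g => ?_
  obtain ⟨t, ht⟩ := exists_eq_ciSup_of_finite
    (f := fun t => 1 / (Fintype.card ι' : ℝ) * ∑ p, g p * h t (z p))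
  rw [← ht]
  exact le_iSup₂ (f := fun (h : Z → ℝ) (_ : h ∈ H) =>
    ((1 / (Fintype.card ι' : ℝ) * ∑ p, g p * h (z p) : ℝ) : EReal)) (h t) (hh t)

/-- Lets the tolerance η tend to 0 although the real bounds `r₁`, `r₂` depend on it. No finiteness
of `G₁`, `G₂` is needed. -/
theorem coe_le_of_approx {x a b c : ℝ} (ha : 0 ≤ a) (hb : 0 ≤ b) (hc : 0 ≤ c) {G₁ G₂ : EReal}
    (h : ∀ η > 0, ∃ r₁ r₂ : ℝ, (r₁ : EReal) ≤ G₁ ∧ (r₂ : EReal) ≤ G₂ ∧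
      x ≤ η + c * (a * r₁ + b * r₂)) :
    (x : EReal) ≤ (c : EReal) * ((a : EReal) * G₁ + (b : EReal) * G₂) := by
  refine EReal.ge_of_forall_gt_iff_ge.1 fun y hy => ?_
  obtain ⟨r₁, r₂, h₁, h₂, hx⟩ := h (x - y) (sub_pos.2 (EReal.coe_lt_coe_iff.1 hy))
  have ha' : (0 : EReal) ≤ a := EReal.coe_nonneg.2 ha
  have hb' : (0 : EReal) ≤ b := EReal.coe_nonneg.2 hb
  have hc' : (0 : EReal) ≤ c := EReal.coe_nonneg.2 hc
  calc (y : EReal) ≤ ((c * (a * r₁ + b * r₂) : ℝ) : EReal) :=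
        EReal.coe_le_coe_iff.2 (by linarith)
    _ = (c : EReal) * ((a : EReal) * r₁ + (b : EReal) * r₂) := by push_cast; rfl
    _ ≤ _ := by gcongr

/-! ### From the loss to the scores -/

/-- The Gaussian coefficients that dominate a loss satisfying a variant Lipschitz condition. -/
noncomputable def coeff {C : ℕ} (L₁ L₂ : ℝ) (y : Fin C) (s : EuclideanSpace ℝ (Fin C)) :
    Option (Fin C) → ℝ
  | none => √Real.pi * L₂ * s y
  | some j => √Real.pi * L₁ * s j

/-- The factor √π cancels the denominator of √(2/π), and the remaining √2 pays for a + b ≤ √2 √(a² +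
b²). -/
theorem IsVariantLipschitz.abs_sub_le_coeff {C : ℕ} {L : Loss C} {L₁ L₂ : ℝ}
    (hLip : IsVariantLipschitz L L₁ L₂) (y : Fin C) (s s' : EuclideanSpace ℝ (Fin C)) :
    |L y s - L y s'| ≤ √(2 / Real.pi) *
      √(∑ k, (coeff L₁ L₂ y s k - coeff L₁ L₂ y s' k) ^ 2) := by
  have h1 : ∑ k, (coeff L₁ L₂ y s k - coeff L₁ L₂ y s' k) ^ 2
      = Real.pi * ((L₁ * ‖s - s'‖) ^ 2 + (L₂ * |s y - s' y|) ^ 2) := by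
    rw [Fintype.sum_option]
    simp only [coeff]
    have h2 : ∀ j, (√Real.pi * L₁ * s j - √Real.pi * L₁ * s' j) ^ 2
        = Real.pi * L₁ ^ 2 * (s j - s' j) ^ 2 := fun j => by
      rw [← mul_sub, mul_pow, mul_pow, Real.sq_sqrt Real.pi_pos.le]
    simp only [h2]
    rw [← Finset.mul_sum, mul_pow L₁, EuclideanSpace.norm_sq_eq, ← mul_sub, mul_pow, mul_pow,
      Real.sq_sqrt Real.pi_pos.le, mul_pow L₂, sq_abs]
    simp only [Real.norm_eq_abs, sq_abs, PiLp.sub_apply]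
    ring
  rw [h1, ← Real.sqrt_mul (by positivity), ← mul_assoc, div_mul_cancel₀ _ Real.pi_pos.ne']
  refine (hLip y s s').trans (Real.le_sqrt_of_sq_le ?_)
  nlinarith [sq_nonneg (L₁ * ‖s - s'‖ - L₂ * |s y - s' y|)]

theorem IsVariantLipschitz.continuous {C : ℕ} {L : Loss C} {L₁ L₂ : ℝ} (hL₁ : 0 ≤ L₁)
    (hL₂ : 0 ≤ L₂) (hLip : IsVariantLipschitz L L₁ L₂) (y : Fin C) : Continuous (L y) := by
  refine (LipschitzWith.of_dist_le_mul (K := (L₁ + L₂).toNNReal) fun s s' => ?_).continuous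
  rw [Real.dist_eq, dist_eq_norm, Real.coe_toNNReal _ (add_nonneg hL₁ hL₂), add_mul]
  refine (hLip y s s').trans (add_le_add_right (mul_le_mul_of_nonneg_left ?_ hL₂) _)
  exact PiLp.norm_apply_le (s - s') y

/-- The empirical Rademacher average of the loss class is controlled by the Gaussian complexities
of the coordinate class on the expanded sample and on the sample. -/
theorem rademacher_lossClass_le {X : Type*} {C n : ℕ} (hC : 0 < C) (hn : 0 < n)
    {F : Set (Score X C)} (hF : F.Nonempty) {L : Loss C} {L₁ L₂ : ℝ} (hL₁ : 0 ≤ L₁) (hL₂ : 0 ≤ L₂)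
    (hLip : IsVariantLipschitz L L₁ L₂) (S : Fin n → X × Fin C) :
    ((2 * ((∑ ε : Fin n → Bool, supSum (lossClass L F) (fun i => sign (ε i)) S) / 2 ^ n) / n : ℝ) :
        EReal) ≤ ((2 * √Real.pi : ℝ) : EReal) *
          (((L₁ * C : ℝ) : EReal) * gaussianComplexity (expandedSample S) (coordClass F)
            + (L₂ : EReal) * gaussianComplexity S (coordClass F)) := by
  have hn' : (0 : ℝ) < n := by exact_mod_cast hn
  have hC' : (0 : ℝ) < C := by exact_mod_cast hC
  refine coe_le_of_approx (by positivity) hL₂ (by positivity) fun η hη => ?_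
  have hne : Nonempty (lossClass L F) := hF.elim fun f hf => ⟨⟨_, f, hf, rfl⟩⟩
  -- The tolerance nη/2 becomes η after multiplication by 2/n.
  have hnear : ∀ ε : Fin n → Bool, ∃ f ∈ F,
      supSum (lossClass L F) (fun i => sign (ε i)) S - n * η / 2
        < ∑ i, sign (ε i) * L (S i).2 (f (S i).1) := fun ε => by
    obtain ⟨⟨_, f, hf, rfl⟩, hlt⟩ := exists_lt_of_lt_ciSup
      (sub_lt_self (supSum (lossClass L F) (fun i => sign (ε i)) S)
        (show 0 < n * η / 2 by positivity))
    exact ⟨f, hf, hlt⟩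
  choose τ hτF hτ using hnear
  set P : Measure (Fin n → Option (Fin C) → ℝ) :=
    Measure.pi fun _ => Measure.pi fun _ => gaussianReal 0 1
  -- Each sample point has C + 1 Gaussians: the entries `some j` serve the expanded sample, the
  -- entry `none` the original one.
  obtain ⟨hU₁, hr₁⟩ := coe_integral_iSup_le_gaussianComplexity
    (φ := fun p : Fin n × Fin C => (p.1, some p.2)) (fun p q h => by
      simp only [Prod.mk.injEq, Option.some.injEq] at h
      exact Prod.ext h.1 h.2)
    (H := coordClass F) (expandedSample S) (fun ε z => τ ε z.1 z.2) fun ε => ⟨_, hτF ε, rfl⟩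
  obtain ⟨hU₂, hr₂⟩ := coe_integral_iSup_le_gaussianComplexity
    (φ := fun i : Fin n => (i, (none : Option (Fin C)))) (fun p q h => (Prod.mk.inj h).1)
    (H := coordClass F) S (fun ε z => τ ε z.1 z.2) fun ε => ⟨_, hτF ε, rfl⟩
  refine ⟨_, _, hr₁, hr₂, ?_⟩
  set U₁ : (Fin n → Option (Fin C) → ℝ) → ℝ := fun w => ⨆ ε : Fin n → Bool,
    1 / (Fintype.card (Fin n × Fin C) : ℝ) *
      ∑ p : Fin n × Fin C, w p.1 (some p.2) * τ ε (expandedSample S p).1 (expandedSample S p).2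
    with hU₁_def
  set U₂ : (Fin n → Option (Fin C) → ℝ) → ℝ := fun w => ⨆ ε : Fin n → Bool,
    1 / (Fintype.card (Fin n) : ℝ) * ∑ i, w i none * τ ε (S i).1 (S i).2 with hU₂_def
  have hcon := rademacher_le_gaussian (fun _ : Fin n → Bool => 0)
    (fun i ε => L (S i).2 (τ ε (S i).1)) (fun i ε => coeff L₁ L₂ (S i).2 (τ ε (S i).1))
    fun i ε ε' => hLip.abs_sub_le_coeff _ _ _
  simp only [zero_add] at hcon
  have hpow : (0 : ℝ) < 2 ^ n := by positivity
  have hR : (∑ ε : Fin n → Bool, supSum (lossClass L F) (fun i => sign (ε i)) S) / 2 ^ n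
      ≤ n * η / 2 + (∑ ε : Fin n → Bool, ⨆ ε' : Fin n → Bool,
        ∑ i, sign (ε i) * L (S i).2 (τ ε' (S i).1)) / 2 ^ n := by
    rw [add_div' _ _ _ hpow.ne']
    refine div_le_div_of_nonneg_right ?_ hpow.le
    have hcard : n * η / 2 * 2 ^ n = ∑ _ε : Fin n → Bool, n * η / 2 := by
      simp [mul_comm]
    rw [hcard, ← Finset.sum_add_distrib]
    refine Finset.sum_le_sum fun ε _ => ?_
    have := le_finite_iSup (fun ε' => ∑ i, sign (ε i) * L (S i).2 (τ ε' (S i).1)) ε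
    linarith [hτ ε]
  -- The supremum of a sum is at most the sum of suprema; the factors n·C and n cancel the
  -- normalizations of `U₁` and `U₂`.
  have hpt : ∀ w : Fin n → Option (Fin C) → ℝ,
      (⨆ ε : Fin n → Bool, ∑ i, ∑ k, w i k * coeff L₁ L₂ (S i).2 (τ ε (S i).1) k)
        ≤ √Real.pi * n * (L₁ * C * U₁ w + L₂ * U₂ w) := fun w => by
    refine ciSup_le fun ε => ?_
    have h1 := le_finite_iSup (fun ε : Fin n → Bool => 1 / (Fintype.card (Fin n × Fin C) : ℝ) *
      ∑ p : Fin n × Fin C,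
        w p.1 (some p.2) * τ ε (expandedSample S p).1 (expandedSample S p).2) ε
    have h2 := le_finite_iSup (fun ε : Fin n → Bool => 1 / (Fintype.card (Fin n) : ℝ) *
      ∑ i, w i none * τ ε (S i).1 (S i).2) ε
    have h3 : ∑ i, ∑ k, w i k * coeff L₁ L₂ (S i).2 (τ ε (S i).1) k
        = √Real.pi * n * (L₁ * C * (1 / (Fintype.card (Fin n × Fin C) : ℝ) *
            ∑ p : Fin n × Fin C,
              w p.1 (some p.2) * τ ε (expandedSample S p).1 (expandedSample S p).2)
          + L₂ * (1 / (Fintype.card (Fin n) : ℝ) * ∑ i, w i none * τ ε (S i).1 (S i).2)) := by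
      simp only [Fintype.card_prod, Fintype.card_fin, Fintype.sum_prod_type, expandedSample,
        Fintype.sum_option, coeff, Finset.sum_add_distrib]
      push_cast
      have e1 : ∑ i, w i none * (√Real.pi * L₂ * τ ε (S i).1 (S i).2)
          = √Real.pi * L₂ * ∑ i, w i none * τ ε (S i).1 (S i).2 := by
        rw [Finset.mul_sum]
        exact Finset.sum_congr rfl fun i _ => by ring
      have e2 : ∑ i, ∑ j, w i (some j) * (√Real.pi * L₁ * τ ε (S i).1 j)
          = √Real.pi * L₁ * ∑ i, ∑ j, w i (some j) * τ ε (S i).1 j := by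
        simp only [Finset.mul_sum]
        exact Finset.sum_congr rfl fun i _ => Finset.sum_congr rfl fun j _ => by ring
      rw [e1, e2]
      field_simp
      ring
    rw [h3]
    simp only [hU₁_def, hU₂_def]
    gcongr
  have hint : ∫ w, ⨆ ε : Fin n → Bool, ∑ i, ∑ k, w i k * coeff L₁ L₂ (S i).2 (τ ε (S i).1) k ∂P
      ≤ √Real.pi * n * (L₁ * C * ∫ w, U₁ w ∂P + L₂ * ∫ w, U₂ w ∂P) := by
    have hi : Integrable (fun w => ⨆ ε : Fin n → Bool,
        ∑ i, ∑ k, w i k * coeff L₁ L₂ (S i).2 (τ ε (S i).1) k) P :=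
      integrable_iSup fun ε => integrable_finsetSum _ fun i _ =>
        (measurePreserving_eval (fun _ : Fin n => Measure.pi fun _ : Option (Fin C) =>
          gaussianReal 0 1) i).integrable_comp_of_integrable (integrable_linearForm_gaussian _)
    refine (integral_mono hi
      (((hU₁.const_mul _).add (hU₂.const_mul _)).const_mul _) hpt).trans_eq ?_
    rw [integral_const_mul, integral_add' (hU₁.const_mul _) (hU₂.const_mul _), integral_const_mul,
      integral_const_mul]
  rw [div_le_iff₀ hn']
  have := hR.trans (add_le_add_right (hcon.trans hint) _)
  linarith

theorem measurable_of_mem_lossClass {X : Type*} [MeasurableSpace X] {C : ℕ} {F : Set (Score X C)}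
    (hF : ∀ f ∈ F, Measurable f) {L : Loss C} (hL : ∀ y, Continuous (L y)) :
    ∀ h ∈ lossClass L F, Measurable h := by
  rintro _ ⟨f, hf, rfl⟩
  exact measurable_from_prod_countable_left fun y => (hL y).measurable.comp (hF f hf)

end GenBound

/-! ### Assembly of the bound -/

theorem proposition2 {X : Type*} [MeasurableSpace X] {C n : ℕ} (hn : 0 < n)
    (D : Measure (X × Fin C)) [IsProbabilityMeasure D]
    (F : Set (GenBound.Score X C)) (hF : ∀ f ∈ F, Measurable f)
    (L : GenBound.Loss C) (hmeas : GenBound.IsMeasurableClass D (GenBound.lossClass L F))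
    (B : ℝ) (hB : 0 < B) (hbdd : ∀ f ∈ F, ∀ (x : X) (y : Fin C), L y (f x) ∈ Set.Icc 0 B)
    (L₁ L₂ : ℝ) (hL₁ : 0 ≤ L₁) (hL₂ : 0 ≤ L₂) (hLip : GenBound.IsVariantLipschitz L L₁ L₂)
    (δ : ℝ) (hδ₀ : 0 < δ) (hδ₁ : δ < 1) :
    ∃ A : Set (Fin n → X × Fin C), MeasurableSet A ∧
      ENNReal.ofReal (1 - δ) ≤ Measure.pi (fun _ : Fin n => D) A ∧
      ∀ S ∈ A, GenBound.genGap D L F B S δ ≤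
        ((2 * √Real.pi : ℝ) : EReal) *
          (((L₁ * C : ℝ) : EReal) *
              GenBound.gaussianComplexity (GenBound.expandedSample S) (GenBound.coordClass F)
            + (L₂ : EReal) * GenBound.gaussianComplexity S (GenBound.coordClass F)) := by
  -- For empty `F` the supremum in the gap is `⊥`, so the bound is trivial.
  rcases F.eq_empty_or_nonempty with rfl | hne
  · refine ⟨Set.univ, MeasurableSet.univ, ?_, fun S _ => ?_⟩
    · rw [measure_univ]
      exact ENNReal.ofReal_le_one.2 (by linarith)
    · simp [GenBound.genGap]
  have hH : (GenBound.lossClass L F).Nonempty := hne.elim fun f hf => ⟨_, f, hf, rfl⟩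
  have hHm := GenBound.measurable_of_mem_lossClass hF (hLip.continuous hL₁ hL₂)
  have hHb : ∀ h ∈ GenBound.lossClass L F, ∀ z, h z ∈ Set.Icc 0 B := by
    rintro _ ⟨f, hf, rfl⟩ z
    exact hbdd f hf z.1 z.2
  obtain ⟨z₀⟩ := D.nonempty_of_neZero
  have hC : 0 < C := z₀.2.pos
  have hn' : (0 : ℝ) < n := by exact_mod_cast hn
  obtain ⟨A, hA, hPA, hdev⟩ :=
    GenBound.exists_uniform_deviation_bound hn hH hHm hmeas hB hHb hδ₀ hδ₁
  refine ⟨A, hA, hPA, fun S hS => ?_⟩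
  refine le_trans ?_ (GenBound.rademacher_lossClass_le hC hn hne hL₁ hL₂ hLip S)
  rw [GenBound.genGap, EReal.sub_le_iff_le_add (Or.inl (EReal.coe_ne_bot _))
    (Or.inl (EReal.coe_ne_top _)), ← EReal.coe_add]
  refine iSup₂_le fun f hf => EReal.coe_le_coe_iff.2 ?_
  have h1 := hdev S hS _ ⟨f, hf, rfl⟩
  -- The deviation bound concerns sums; this rescales its error term to means.
  have h2 : √(n * Real.log (2 / δ) / 2) = n * √(Real.log (2 / δ) / (2 * n)) := by
    rw [show n * Real.log (2 / δ) / 2 = (n : ℝ) ^ 2 * (Real.log (2 / δ) / (2 * n)) by field_simp,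
      Real.sqrt_mul (sq_nonneg _), Real.sqrt_sq hn'.le]
  rw [h2] at h1
  rw [GenBound.risk, GenBound.empRisk, div_add' _ _ _ hn'.ne', le_div_iff₀ hn']
  have h3 : (∫ z, L z.2 (f z.1) ∂D - 1 / (n : ℝ) * ∑ i, L (S i).2 (f (S i).1)) * n
      = n * ∫ z, L z.2 (f z.1) ∂D - ∑ i, L (S i).2 (f (S i).1) := by
    field_simp
  rw [h3]
  linarith
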